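/- Let $X=[-1,1]$. For $\alpha,\beta>-1$ let $\rho_X$ be the Jacobi probability measure $d\rho_X(x)=c\,(1-x)^\alpha(1+x)^\beta\,dx$ on $X$, where $c=\big(\int_{-1}^1(1-x)^\alpha(1+x)^\beta\,dx\big)^{-1}$, put $\gamma=\max\{\alpha,\beta\}$, and let $\bar c=\frac{c\,2^{\min\{\alpha,\beta\}}}{1+\gamma}$. Write $\|v\|=\big(\int_X|v|^2\,d\rho_X\big)^{1/2}$, and for sample points $x_1,\dots,x_n$ write $\|v\|_{n,2}=\big(\frac1n\sum_{i=1}^n|v(x_i)|^2\big)^{1/2}$. Let $P_m^n(f)$ be a minimizer of $\|p-f\|_{n,2}$ over the real polynomials $p$ of degree at most $m$ (unique if at least $m+1$ of the sample points are distinct), and let $$\kappa_2(P_m^n)=\sup_f\lim_{\delta\to0^+}\sup_{0<\|h\|_{n,2}\le\delta}\frac{\|P_m^n(f+h)-P_m^n(f)\|}{\|h\|_{n,2}}.$$ Theorem. Assume $\gamma>-1/2$, let $0<\tau\le1$ with $\tau>\frac1{2(1+\gamma)}$, let $m=m(n)<n$ be such that $n\asymp m^{1/\tau}$, that is, $a\,m^{1/\tau}\le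 n\le b\,m^{1/\tau}$ for all sufficiently large $n$, with constants $a,b>0$, and let $C_0>0$. Then there are constants $\nu>1$, depending only on $\gamma$, $b$ and $C_0$, and $\eta>0$, depending only on $\gamma$, $a$, $b$ and $C_0$, such that for every constant $C\ge C_0$ with $C>2e^2\bar c$ the following holds. If for each $n$ the points $x_1,\dots,x_n$ are i.i.d. with law $\rho_X$, then for all sufficiently large $n$, with probability at least $1-\frac{2e^2\bar c}{C}$, $$\kappa_2(P_m^n)\ \ge\ \frac{\eta}{n^{(1+\gamma)\tau}}\;\nu^{\,n^r/C^{\frac1{1+2\gamma}}},\qquad r=\frac{2(1+\gamma)\tau-1}{1+2\gamma}.$$ -/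

import Mathlib

universe u

open Real Set Filter Topology MeasureTheory ProbabilityTheory Polynomial
open scoped ENNReal

noncomputable section

namespace LeastSquares

/-- The normalizing constant `c` of the Jacobi weight with parameters `α, β > -1`. -/
def jacobiConst (α β : ℝ) : ℝ :=
  (∫ x in (-1 : ℝ)..1, (1 - x) ^ α * (1 + x) ^ β)⁻¹

/-- The Jacobi weight `w(x) = c (1 - x)^α (1 + x)^β` (used on `[-1, 1]` only). -/
def jacobiWeight (α β x : ℝ) : ℝ :=
  jacobiConst α β * (1 - x) ^ α * (1 + x) ^ β

/-- The probability measure `dρ_X = w(x) dx` on `X = [-1, 1]`. -/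
def jacobiMeasure (α β : ℝ) : Measure ℝ :=
  (volume.restrict (Icc (-1) 1)).withDensity fun x => ENNReal.ofReal (jacobiWeight α β x)

/-- The constant `c̄ = c 2^{min{α,β}} / (1 + max{α,β})`. -/
def cbar (α β : ℝ) : ℝ :=
  jacobiConst α β * 2 ^ (min α β) / (1 + max α β)

/-- The norm `‖v‖ = (∫ |v|² dρ)^{1/2}` of `L²(ρ)`. -/
def l2Norm (ρ : Measure ℝ) (v : ℝ → ℝ) : ℝ :=
  √(∫ t, v t ^ 2 ∂ρ)

/-- The empirical semi-norm `‖v‖_{n,2} = (n⁻¹ ∑ |v(x_i)|²)^{1/2}` of the sample `x`. -/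
def empNorm {n : ℕ} (x : Fin n → ℝ) (v : ℝ → ℝ) : ℝ :=
  √((1 / (n : ℝ)) * ∑ i, v (x i) ^ 2)

/-- `p` minimizes `‖p - f‖_{n,2}` among the polynomials of degree at most `m`. -/
def IsLeastSquaresFit {n : ℕ} (m : ℕ) (x : Fin n → ℝ) (f : ℝ → ℝ) (p : ℝ[X]) : Prop :=
  p ∈ degreeLE ℝ (m : WithBot ℕ) ∧
    ∀ q ∈ degreeLE ℝ (m : WithBot ℕ),
      empNorm x (fun t => p.eval t - f t) ≤ empNorm x (fun t => q.eval t - f t)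

/-- A least squares fit always exists. -/
theorem exists_isLeastSquaresFit {n : ℕ} (m : ℕ) (x : Fin n → ℝ) (f : ℝ → ℝ) :
    ∃ p, IsLeastSquaresFit m x f p := by
  let L : ℝ[X] →ₗ[ℝ] EuclideanSpace ℝ (Fin n) :=
    { toFun := fun p => WithLp.toLp 2 fun i => p.eval (x i)
      map_add' := fun p q => by ext i; simp
      map_smul' := fun c p => by ext i; simp }
  let K : Submodule ℝ (EuclideanSpace ℝ (Fin n)) := (degreeLE ℝ (m : WithBot ℕ)).map L
  let u : EuclideanSpace ℝ (Fin n) := WithLp.toLp 2 fun i => f (x i)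
  obtain ⟨v, hv, hmin⟩ := K.exists_norm_eq_iInf_of_complete_subspace
    (Submodule.complete_of_finiteDimensional K) u
  obtain ⟨p, hp, rfl⟩ := hv
  have key : ∀ q : ℝ[X], empNorm x (fun t => q.eval t - f t) = √(1 / (n : ℝ)) * ‖u - L q‖ := by
    intro q
    rw [norm_sub_rev, EuclideanSpace.norm_eq, empNorm, Real.sqrt_mul (by positivity)]
    simp [L, u]
  refine ⟨p, hp, fun q hq => ?_⟩
  rw [key, key, hmin]
  refine mul_le_mul_of_nonneg_left ?_ (Real.sqrt_nonneg _)
  exact ciInf_le (f := fun w : K => ‖u - w‖)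
    ⟨0, by rintro _ ⟨w, rfl⟩; exact norm_nonneg _⟩ ⟨L q, Submodule.mem_map_of_mem hq⟩

/-- The discrete least squares operator `P_m^n` of the sample `x = (x_1, …, x_n)`.  The minimizer
is unique as soon as `m + 1` of the sample points are distinct; otherwise some minimizer is
chosen. -/
def lsProj {n : ℕ} (m : ℕ) (x : Fin n → ℝ) (f : ℝ → ℝ) : ℝ → ℝ :=
  fun t => (Classical.choose (exists_isLeastSquaresFit m x f)).eval t

/-- The supremum of `‖φ(f + h) - φ(f)‖ / ‖h‖_{n,2}` over all `h` with `0 < ‖h‖_{n,2} ≤ δ`. -/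
def localGain {n : ℕ} (ρ : Measure ℝ) (x : Fin n → ℝ) (φ : (ℝ → ℝ) → ℝ → ℝ) (f : ℝ → ℝ)
    (δ : ℝ) : ℝ≥0∞ :=
  ⨆ (h : ℝ → ℝ) (_ : 0 < empNorm x h ∧ empNorm x h ≤ δ),
    ENNReal.ofReal (l2Norm ρ (fun t => φ (f + h) t - φ f t) / empNorm x h)

/-- The condition number `κ₂(φ) = sup_f lim_{δ → 0+} sup_{0 < ‖h‖_{n,2} ≤ δ}
‖φ(f + h) - φ(f)‖ / ‖h‖_{n,2}`, with values in `[0, ∞]`.  The limit is written as an infimum over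
`δ > 0`, see `tendsto_localGain`.  For operators that depend on a function through its
values at the sample points only, it does not matter that `f` and `h` are defined on all of `ℝ`. -/
def condNumber {n : ℕ} (ρ : Measure ℝ) (x : Fin n → ℝ) (φ : (ℝ → ℝ) → ℝ → ℝ) : ℝ≥0∞ :=
  ⨆ f : ℝ → ℝ, ⨅ (δ : ℝ) (_ : 0 < δ), localGain ρ x φ f δ

/-- The infimum in `condNumber` is the limit as `δ → 0+`. -/
theorem tendsto_localGain {n : ℕ} (ρ : Measure ℝ) (x : Fin n → ℝ) (φ : (ℝ → ℝ) → ℝ → ℝ)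
    (f : ℝ → ℝ) :
    Tendsto (localGain ρ x φ f) (𝓝[>] 0) (𝓝 (⨅ (δ : ℝ) (_ : 0 < δ), localGain ρ x φ f δ)) := by
  have hmono : Monotone (localGain ρ x φ f) := fun δ δ' h =>
    iSup_mono fun _ => iSup_mono' fun hh => ⟨⟨hh.1, hh.2.trans h⟩, le_rfl⟩
  have := hmono.tendsto_nhdsGT 0
  rwa [sInf_image] at this

end LeastSquares

end

/-!
Let `σ = ±1` be the endpoint of `[-1, 1]` where the weight has the exponent `γ = max α β`, and write
`y = 1 - σ x` for the distance to it. The zone `y ≤ ε` has mass at most `2 c̄ ε ^ (1 + γ)`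
(`jacobiMeasure_zone_le`), so by Markov's inequality it holds fewer than `K = C n ε ^ (1 + γ) / e²`
of the `n` sample points with probability at least `1 - 2 e² c̄ / C`. On this event, and if the
sample points are distinct, there is a polynomial of degree at most `m` that is bounded by one at
all sample points, while its `L²(ρ)`-norm is `2 ^ K` or more, up to powers of `ε`
(`exists_polynomial_zone`). The least squares operator reproduces this polynomial, so the norm is a
lower bound for the condition number (`ofReal_l2Norm_le_condNumber`).

The polynomial is a product of `k = ⌈K⌉` factors `S (S - s) / (1 + s)`, one for each sample point in
the zone and some more for artificial points there, where `S = T_L(ε + σ x)` is a shifted Chebyshev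
polynomial and `s ≥ 1` is the value of `S` at the point. A factor vanishes at its point, and it is
at most one in absolute value outside the zone because `|S| ≤ 1` there. For `y ≤ ε / 2` it is at
least `L² |y - y_i| / 2`, because `T_L' ≥ L²` on `[1, ∞)`. The mean of `log |y - y_i|` over `ε / 4 ≤
y ≤ ε / 2` is at least `log (ε / 8) - 1` wherever `y_i` lies, so Jensen's inequality shows that the
product is at least `(L² ε / (16 e)) ^ k` in quadratic mean (`le_integral_prod_sub_sq`). This is at
least `2 ^ k` if `L² ε ≥ 32 e`, so a degree `2 L` of order `ε ^ (-1/2)` is enough for one factor.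
The total degree `2 L k` is then at most `m` if `k` is at most a small multiple of `m √ε`. Equating
`C n ε ^ (1 + γ)` with a multiple of `m √ε` leads to `ε = (lam m / (n C)) ^ (2 / (1 + 2 γ))`, and `m
√ε` is then at least a multiple of `n ^ r / C ^ (1 / (1 + 2 γ))` (`le_mul_rpow_zone`). The factors
that are powers of `ε`, hence of `n`, are absorbed by half of the exponential growth
(`eventually_growth`), so `η = 1` suffices.
-/

noncomputable section

namespace LeastSquares

/-! ### Chebyshev polynomials of degree a power of two -/

/-- The `j`-fold iterate of `2 X ^ 2 - 1`, which is the Chebyshev polynomial of degree `2 ^ j`. -/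
def chebIter : ℕ → ℝ[X]
  | 0 => X
  | j + 1 => C 2 * chebIter j ^ 2 - 1

theorem eval_chebIter_succ (j : ℕ) (t : ℝ) :
    (chebIter (j + 1)).eval t = 2 * (chebIter j).eval t ^ 2 - 1 := by
  simp [chebIter]

theorem natDegree_chebIter_le (j : ℕ) : (chebIter j).natDegree ≤ 2 ^ j := by
  induction j with
  | zero => simp [chebIter]
  | succ j ih =>
    rw [chebIter]
    refine (natDegree_sub_le _ _).trans (max_le ?_ (by simp))
    refine (natDegree_C_mul_le _ _).trans (natDegree_pow_le.trans ?_)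
    rw [pow_succ]; omega

theorem abs_eval_chebIter_le_one (j : ℕ) {t : ℝ} (ht : |t| ≤ 1) :
    |(chebIter j).eval t| ≤ 1 := by
  induction j with
  | zero => simpa [chebIter] using ht
  | succ j ih =>
    rw [eval_chebIter_succ, abs_le]
    have := sq_le_one_iff_abs_le_one ((chebIter j).eval t) |>.2 ih
    constructor <;> nlinarith [sq_nonneg ((chebIter j).eval t)]

theorem one_le_eval_chebIter (j : ℕ) {t : ℝ} (ht : 1 ≤ t) : 1 ≤ (chebIter j).eval t := by
  induction j with
  | zero => simpa [chebIter] using ht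
  | succ j ih => rw [eval_chebIter_succ]; nlinarith

/-- The derivative of the Chebyshev polynomial of degree `2 ^ j` is at least `4 ^ j` on
`[1, ∞)`. -/
theorem le_eval_chebIter_sub (j : ℕ) {s t : ℝ} (hs : 1 ≤ s) (hst : s ≤ t) :
    4 ^ j * (t - s) ≤ (chebIter j).eval t - (chebIter j).eval s := by
  induction j with
  | zero => simp [chebIter]
  | succ j ih =>
    have h1 := one_le_eval_chebIter j hs
    have h2 := one_le_eval_chebIter j (hs.trans hst)
    have h3 : 0 ≤ (4 : ℝ) ^ j * (t - s) := mul_nonneg (by positivity) (by linarith)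
    rw [eval_chebIter_succ, eval_chebIter_succ, pow_succ]
    nlinarith

theorem abs_eval_chebIter_sub_ge (j : ℕ) {s t : ℝ} (hs : 1 ≤ s) (ht : 1 ≤ t) :
    4 ^ j * |t - s| ≤ |(chebIter j).eval t - (chebIter j).eval s| := by
  rcases le_total s t with h | h
  · rw [abs_of_nonneg (sub_nonneg.2 h)]
    exact (le_eval_chebIter_sub j hs h).trans (le_abs_self _)
  · rw [abs_sub_comm, abs_of_nonneg (sub_nonneg.2 h), abs_sub_comm]
    exact (le_eval_chebIter_sub j ht h).trans (le_abs_self _)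

/-! ### A polynomial with one zero in the endpoint zone -/

/-- The gain of one factor `a (a - b) / (1 + b)`, where `a` and `b` are the values of the Chebyshev
polynomial at a point of the zone and at the zero. It does not depend on the size of `b`. -/
theorem half_le_mul_abs_sub_div {a b z : ℝ} (hb : 1 ≤ b) (hz : 0 ≤ z) (hza : 1 + z ≤ a)
    (h : z ≤ |a - b|) : z / 2 ≤ |a * (a - b) / (1 + b)| := by
  rw [abs_div, abs_mul, abs_of_pos (by linarith : 0 < a), abs_of_pos (by linarith : 0 < 1 + b),
    le_div_iff₀ (by linarith)]
  rcases le_total b a with hab | hab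
  · rw [abs_of_nonneg (by linarith)] at h ⊢
    nlinarith
  · rw [abs_of_nonpos (by linarith)] at h ⊢
    nlinarith [mul_nonneg (sub_nonneg.2 hza) (sub_nonneg.2 h), mul_nonneg hz (sub_nonneg.2 h)]

/-- One factor of the polynomial that is small outside the endpoint zone: it vanishes where
`1 - σ x = c`. -/
def zoneFactor (σ ε : ℝ) (j : ℕ) (c : ℝ) : ℝ[X] :=
  let S := (chebIter j).comp (C ε + C σ * X)
  let s := (chebIter j).eval (1 + ε - c)
  C (1 + s)⁻¹ * (S * (S - C s))

theorem eval_zoneFactor (σ ε : ℝ) (j : ℕ) (c x : ℝ) :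
    (zoneFactor σ ε j c).eval x =
      (chebIter j).eval (ε + σ * x) *
        ((chebIter j).eval (ε + σ * x) - (chebIter j).eval (1 + ε - c)) /
        (1 + (chebIter j).eval (1 + ε - c)) := by
  simp [zoneFactor, eval_comp]
  ring

theorem natDegree_zoneFactor_le (σ ε : ℝ) (j : ℕ) (c : ℝ) :
    (zoneFactor σ ε j c).natDegree ≤ 2 * 2 ^ j := by
  have hS : ((chebIter j).comp (C ε + C σ * X)).natDegree ≤ 2 ^ j := by
    refine natDegree_comp_le.trans ?_
    have h1 : (C ε + C σ * X : ℝ[X]).natDegree ≤ 1 := by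
      refine (natDegree_add_le _ _).trans (max_le (by simp) ?_)
      exact (natDegree_C_mul_le _ _).trans natDegree_X_le
    calc _ ≤ 2 ^ j * 1 := Nat.mul_le_mul (natDegree_chebIter_le j) h1
      _ = _ := mul_one _
  rw [zoneFactor]
  refine (natDegree_C_mul_le _ _).trans (natDegree_mul_le.trans ?_)
  rw [natDegree_sub_C]
  omega

theorem eval_zoneFactor_eq_zero (σ ε : ℝ) (j : ℕ) {c x : ℝ} (h : 1 - σ * x = c) :
    (zoneFactor σ ε j c).eval x = 0 := by
  rw [eval_zoneFactor, ← h, show 1 + ε - (1 - σ * x) = ε + σ * x by ring]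
  simp

theorem abs_eval_zoneFactor_le_one (σ : ℝ) {ε : ℝ} (hε : 0 ≤ ε) (j : ℕ) {c x : ℝ} (hc : c ≤ ε)
    (h1 : ε ≤ 1 - σ * x) (h2 : 1 - σ * x ≤ 2) : |(zoneFactor σ ε j c).eval x| ≤ 1 := by
  have hs := one_le_eval_chebIter j (show 1 ≤ 1 + ε - c by linarith)
  have hS := abs_eval_chebIter_le_one j (t := ε + σ * x)
    (abs_le.2 ⟨by linarith, by linarith⟩)
  rw [eval_zoneFactor, abs_div, abs_mul, div_le_one (abs_pos.2 (by linarith)),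
    abs_of_pos (by linarith : 0 < 1 + (chebIter j).eval (1 + ε - c))]
  have h3 : |(chebIter j).eval (ε + σ * x) - (chebIter j).eval (1 + ε - c)| ≤
      1 + (chebIter j).eval (1 + ε - c) := by
    rw [abs_le] at hS ⊢
    constructor <;> linarith
  nlinarith [abs_nonneg ((chebIter j).eval (ε + σ * x) - (chebIter j).eval (1 + ε - c))]

theorem le_abs_eval_zoneFactor {σ ε : ℝ} (j : ℕ) {c x : ℝ} (hc : c ∈ Icc 0 ε)
    (hx : 1 - σ * x ∈ Icc 0 (ε / 2)) :
    4 ^ j * |1 - σ * x - c| / 2 ≤ |(zoneFactor σ ε j c).eval x| := by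
  obtain ⟨hc0, hc1⟩ := hc
  obtain ⟨hx0, hx1⟩ := hx
  rw [eval_zoneFactor]
  have hp : (0 : ℝ) < 4 ^ j := by positivity
  refine half_le_mul_abs_sub_div (one_le_eval_chebIter j (by linarith)) (by positivity) ?_ ?_
  · have h := le_eval_chebIter_sub j (s := 1) (t := ε + σ * x) le_rfl (by linarith)
    have h1 := one_le_eval_chebIter j (le_refl (1 : ℝ))
    have h2 : |1 - σ * x - c| ≤ ε + σ * x - 1 := abs_le.2 ⟨by linarith, by linarith⟩
    nlinarith [mul_le_mul_of_nonneg_left h2 hp.le]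
  · have h := abs_eval_chebIter_sub_ge j (s := 1 + ε - c) (t := ε + σ * x)
      (by linarith) (by linarith)
    rwa [show ε + σ * x - (1 + ε - c) = -(1 - σ * x - c) by ring, abs_neg] at h

/-! ### The mean of a product with zeros near an interval -/

/-- The average of `log |y - c|` over an interval of length `ℓ` is smallest when `c` is the
midpoint. -/
theorem le_integral_log_sub (u c : ℝ) {ℓ : ℝ} (hℓ : 0 < ℓ) :
    ℓ * (log (ℓ / 2) - 1) ≤ ∫ y in u..u + ℓ, log (y - c) := by
  rw [intervalIntegral.integral_comp_sub_right (fun y => log y) c, integral_log]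
  obtain ⟨p, hp⟩ : ∃ p, p = u - c := ⟨_, rfl⟩
  rw [show u + ℓ - c = p + ℓ by linarith, ← hp]
  suffices h : ℓ * log (ℓ / 2) ≤ (p + ℓ) * log (p + ℓ) - p * log p by linarith
  rcases le_total 0 p with h0 | h0
  · have h1 : log (ℓ / 2) ≤ log (p + ℓ) := log_le_log (by linarith) (by linarith)
    have h2 : p * log p ≤ p * log (p + ℓ) := by
      rcases h0.eq_or_lt with rfl | h0
      · simp
      · exact mul_le_mul_of_nonneg_left (log_le_log h0 (by linarith)) h0.le
    nlinarith [mul_le_mul_of_nonneg_left h1 hℓ.le]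
  rcases le_total (p + ℓ) 0 with h3 | h3
  · have h1 : log (ℓ / 2) ≤ log (-p) := log_le_log (by linarith) (by linarith)
    have h2 : -(p + ℓ) * log (-(p + ℓ)) ≤ -(p + ℓ) * log (-p) := by
      rcases h3.eq_or_lt with h | h
      · simp [h]
      · exact mul_le_mul_of_nonneg_left (log_le_log (by linarith) (by linarith)) (by linarith)
    rw [log_neg_eq_log] at h1
    rw [log_neg_eq_log, log_neg_eq_log] at h2
    nlinarith [mul_le_mul_of_nonneg_left h1 hℓ.le]
  · have h := convexOn_mul_log.2 (mem_Ici.2 h3) (mem_Ici.2 (neg_nonneg.2 h0))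
      (show (0 : ℝ) ≤ 1 / 2 by norm_num) (show (0 : ℝ) ≤ 1 / 2 by norm_num) (by norm_num)
    simp only [smul_eq_mul, log_neg_eq_log] at h
    rw [show 1 / 2 * (p + ℓ) + 1 / 2 * -p = ℓ / 2 by ring] at h
    linarith

/-- Jensen's inequality for `exp`, applied to the sum of the logarithms of the factors. -/
theorem le_integral_prod_sub_sq {ι : Type*} (A : Finset ι) (c : ι → ℝ) (u : ℝ) {ℓ w : ℝ}
    (hℓ : 0 < ℓ) (hw : 0 < w) :
    ℓ * (w * ℓ / (2 * exp 1)) ^ (2 * A.card) ≤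
      ∫ y in u..u + ℓ, ∏ i ∈ A, (w * (y - c i)) ^ 2 := by
  set t₀ : ℝ := 2 * A.card * log (w * ℓ / (2 * exp 1)) with ht₀
  have hbase : 0 < w * ℓ / (2 * exp 1) := by positivity
  have he : (w * ℓ / (2 * exp 1)) ^ (2 * A.card) = exp t₀ := by
    rw [ht₀, mul_comm (2 * (A.card : ℝ)), exp_mul, exp_log hbase, ← rpow_natCast]
    push_cast; rfl
  have hlog : log (w * ℓ / (2 * exp 1)) = log w + (log (ℓ / 2) - 1) := by
    rw [show w * ℓ / (2 * exp 1) = w * (ℓ / 2 / exp 1) by field_simp,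
      log_mul hw.ne' (by positivity), log_div (by positivity) (exp_pos 1).ne', log_exp]
  set f : ℝ → ℝ := fun y => ∑ i ∈ A, 2 * (log w + log (y - c i)) with hf
  have hli : ∀ i, IntervalIntegrable (fun y => log (y - c i)) volume u (u + ℓ) := fun i => by
    have := (intervalIntegral.intervalIntegrable_log'
      (a := u - c i) (b := u + ℓ - c i)).comp_sub_right (c i)
    simpa using this
  have hint : ∀ i ∈ A, IntervalIntegrable (fun y => 2 * (log w + log (y - c i)))
      volume u (u + ℓ) := fun i _ => (intervalIntegrable_const.add (hli i)).const_mul 2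
  have hfi : IntervalIntegrable f volume u (u + ℓ) := by
    have := IntervalIntegrable.sum A hint
    refine this.congr_ae ?_
    exact Eventually.of_forall fun y => by simp [hf]
  have hsum : ℓ * t₀ ≤ ∫ y in u..u + ℓ, f y := by
    rw [hf, intervalIntegral.integral_finsetSum hint]
    have : ∀ i ∈ A, ℓ * (2 * log (w * ℓ / (2 * exp 1))) ≤
        ∫ y in u..u + ℓ, 2 * (log w + log (y - c i)) := by
      intro i _
      rw [intervalIntegral.integral_const_mul,
        intervalIntegral.integral_add intervalIntegrable_const (hli i),
        intervalIntegral.integral_const, smul_eq_mul, hlog]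
      have := le_integral_log_sub u (c i) hℓ
      nlinarith
    refine le_trans (le_of_eq ?_) (Finset.sum_le_sum this)
    rw [Finset.sum_const, nsmul_eq_mul, ht₀]; ring
  have hgi : IntervalIntegrable (fun y => exp t₀ * (1 + (f y - t₀))) volume u (u + ℓ) :=
    (intervalIntegrable_const.add (hfi.sub intervalIntegrable_const)).const_mul _
  have hmain : ∫ y in u..u + ℓ, exp t₀ * (1 + (f y - t₀)) ≤
      ∫ y in u..u + ℓ, ∏ i ∈ A, (w * (y - c i)) ^ 2 := by
    refine intervalIntegral.integral_mono_ae (by linarith) hgi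
      (Continuous.intervalIntegrable (by fun_prop) _ _) ?_
    -- The logarithm has a junk value at the points `c i`.
    have hfin : ∀ᵐ y : ℝ, y ∉ (A.image c : Set ℝ) :=
      (measure_eq_zero_iff_ae_notMem).1 ((A.image c).finite_toSet.measure_zero _)
    filter_upwards [hfin] with y hy
    have hprod : ∏ i ∈ A, (w * (y - c i)) ^ 2 = exp (f y) := by
      rw [hf, exp_sum]
      refine Finset.prod_congr rfl fun i hi => ?_
      have hne : y - c i ≠ 0 := fun h0 => hy (by
        rw [Finset.mem_coe, Finset.mem_image]; exact ⟨i, hi, by linarith⟩)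
      rw [← log_mul hw.ne' hne, mul_comm 2, exp_mul, ← log_abs, exp_log (by positivity)]
      norm_cast
      rw [sq_abs]
    rw [hprod]
    calc exp t₀ * (1 + (f y - t₀)) ≤ exp t₀ * exp (f y - t₀) := by
          gcongr; linarith [add_one_le_exp (f y - t₀)]
      _ = exp (f y) := by rw [← exp_add]; ring_nf
  refine le_trans ?_ hmain
  rw [intervalIntegral.integral_const_mul,
    intervalIntegral.integral_add intervalIntegrable_const
      (hfi.sub intervalIntegrable_const),
    intervalIntegral.integral_sub hfi intervalIntegrable_const, intervalIntegral.integral_const,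
    intervalIntegral.integral_const, he, smul_eq_mul, smul_eq_mul]
  have := exp_pos t₀
  nlinarith

theorem le_integral_prod_zone {ι : Type*} (A : Finset ι) (c : ι → ℝ) {ε : ℝ} (hε : 0 < ε) (j : ℕ)
    (hj : 32 * exp 1 ≤ 4 ^ j * ε) :
    ε / 4 * 4 ^ A.card ≤ ∫ y in ε / 4..ε / 2, ∏ i ∈ A, (4 ^ j / 2 * (y - c i)) ^ 2 := by
  have h := le_integral_prod_sub_sq A c (ε / 4) (ℓ := ε / 4) (w := 4 ^ j / 2) (by positivity)
    (by positivity)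
  rw [show ε / 4 + ε / 4 = ε / 2 by ring] at h
  refine le_trans ?_ h
  rw [pow_mul]
  have h2 : (2 : ℝ) ≤ 4 ^ j / 2 * (ε / 4) / (2 * exp 1) := by
    rw [le_div_iff₀ (by positivity)]; linarith
  gcongr
  nlinarith

/-! ### The condition number of the least squares operator -/

theorem empNorm_eq_zero {n : ℕ} {x : Fin n → ℝ} {v : ℝ → ℝ} (h : empNorm x v = 0) (i : Fin n) :
    v (x i) = 0 := by
  have hn : (0 : ℝ) < n := by exact_mod_cast (Fin.pos i)
  rw [empNorm, sqrt_eq_zero (by positivity), mul_eq_zero] at h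
  have h0 := h.resolve_left (by positivity)
  rw [Finset.sum_eq_zero_iff_of_nonneg fun i _ => sq_nonneg _] at h0
  exact pow_eq_zero_iff two_ne_zero |>.1 (h0 i (Finset.mem_univ i))

theorem empNorm_le_one {n : ℕ} {x : Fin n → ℝ} {v : ℝ → ℝ} (h : ∀ i, |v (x i)| ≤ 1) :
    empNorm x v ≤ 1 := by
  rw [empNorm, sqrt_le_iff, one_pow]
  refine ⟨zero_le_one, ?_⟩
  rcases n.eq_zero_or_pos with rfl | hn
  · simp
  have hn' : (0 : ℝ) < n := by exact_mod_cast hn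
  rw [one_div_mul_eq_div, div_le_one hn']
  calc ∑ i, v (x i) ^ 2 ≤ ∑ _i : Fin n, (1 : ℝ) :=
        Finset.sum_le_sum fun i _ => (sq_le_one_iff_abs_le_one _).2 (h i)
    _ = n := by simp

theorem empNorm_const_mul {n : ℕ} (x : Fin n → ℝ) (v : ℝ → ℝ) {s : ℝ} (hs : 0 ≤ s) :
    empNorm x (fun t => s * v t) = s * empNorm x v := by
  rw [empNorm, empNorm]
  simp_rw [mul_pow]
  rw [← Finset.mul_sum, mul_left_comm, sqrt_mul (by positivity), sqrt_sq hs]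

theorem l2Norm_const_mul (ρ : Measure ℝ) (v : ℝ → ℝ) {s : ℝ} (hs : 0 ≤ s) :
    l2Norm ρ (fun t => s * v t) = s * l2Norm ρ v := by
  rw [l2Norm, l2Norm]
  simp_rw [mul_pow]
  rw [integral_const_mul, sqrt_mul (by positivity), sqrt_sq hs]

theorem eq_of_forall_eval_eq {n m : ℕ} {x : Fin n → ℝ} (hx : Function.Injective x) (hmn : m < n)
    {p q : ℝ[X]} (hp : p ∈ degreeLE ℝ (m : WithBot ℕ)) (hq : q ∈ degreeLE ℝ (m : WithBot ℕ))
    (h : ∀ i, p.eval (x i) = q.eval (x i)) : p = q := by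
  have hlt : (m : WithBot ℕ) < (Finset.univ : Finset (Fin n)).card := by
    simpa using hmn
  exact eq_of_degrees_lt_of_eval_index_eq Finset.univ hx.injOn ((mem_degreeLE.1 hp).trans_lt hlt)
    ((mem_degreeLE.1 hq).trans_lt hlt) fun i _ => h i

/-- The least squares operator reproduces polynomials of degree at most `m`. -/
theorem lsProj_eval {n m : ℕ} {x : Fin n → ℝ} (hx : Function.Injective x) (hmn : m < n)
    {q : ℝ[X]} (hq : q ∈ degreeLE ℝ (m : WithBot ℕ)) :
    lsProj m x (fun t => q.eval t) = fun t => q.eval t := by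
  have hspec := Classical.choose_spec (exists_isLeastSquaresFit m x fun t => q.eval t)
  have h0 : empNorm x (fun t => q.eval t - q.eval t) = 0 := by simp [empNorm]
  have h1 := hspec.2 q hq
  rw [h0] at h1
  have h2 := empNorm_eq_zero (le_antisymm h1 (sqrt_nonneg _))
  have h3 := eq_of_forall_eval_eq hx hmn hspec.1 hq fun i => sub_eq_zero.1 (h2 i)
  funext t
  rw [lsProj, h3]

/-- The condition number at `f = 0` in the direction of a polynomial `q` that is at most one at the
sample points. -/
theorem ofReal_l2Norm_le_condNumber {n m : ℕ} (ρ : Measure ℝ) {x : Fin n → ℝ}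
    (hx : Function.Injective x) (hmn : m < n) {q : ℝ[X]}
    (hq : q ∈ degreeLE ℝ (m : WithBot ℕ)) (hq1 : ∀ i, |q.eval (x i)| ≤ 1) :
    ENNReal.ofReal (l2Norm ρ fun t => q.eval t) ≤ condNumber ρ x (lsProj m x) := by
  rcases eq_or_ne q 0 with rfl | hq0
  · simp [l2Norm]
  have hle := empNorm_le_one (v := fun t => q.eval t) hq1
  have hpos : 0 < empNorm x fun t => q.eval t := by
    refine lt_of_le_of_ne (sqrt_nonneg _) fun h0 => hq0 ?_
    exact eq_of_forall_eval_eq hx hmn hq (Submodule.zero_mem _) fun i => by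
      simpa using empNorm_eq_zero h0.symm i
  refine le_trans ?_ (le_iSup _ (fun _ => (0 : ℝ)))
  refine le_iInf₂ fun δ hδ => ?_
  refine le_trans ?_ (le_iSup₂ (fun t => δ * q.eval t) ?_)
  · have hδq : (fun t => δ * q.eval t) = fun t => (C δ * q).eval t := by
      ext t; simp
    have e1 : lsProj m x ((fun _ => (0 : ℝ)) + fun t => δ * q.eval t) =
        fun t => δ * q.eval t := by
      rw [show ((fun _ => (0 : ℝ)) + fun t => δ * q.eval t) = fun t => δ * q.eval t by
        ext t; simp, hδq]
      refine lsProj_eval hx hmn ?_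
      rw [← smul_eq_C_mul]
      exact Submodule.smul_mem _ _ hq
    have e2 : lsProj m x (fun _ => (0 : ℝ)) = fun _ => 0 := by
      simpa using lsProj_eval hx hmn (Submodule.zero_mem (degreeLE ℝ (m : WithBot ℕ)))
    rw [e1, e2]
    simp only [sub_zero]
    rw [l2Norm_const_mul _ _ hδ.le, empNorm_const_mul _ _ hδ.le,
      mul_div_mul_left _ _ hδ.ne']
    exact ENNReal.ofReal_le_ofReal (le_div_self (sqrt_nonneg _) hpos hle)
  · rw [empNorm_const_mul _ _ hδ.le]
    exact ⟨mul_pos hδ hpos, mul_le_of_le_one_right hδ.le hle⟩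

/-! ### A polynomial that is large only in the endpoint zone -/

/-- A polynomial that vanishes at the sample points of the zone `1 - σ x ≤ ε`, is bounded by one at
the others, and is exponentially large in the mean on a part of the zone.  The padding of the set of
zeros to exactly `k` elements ensures growth also if the zone holds few points. -/
theorem exists_polynomial_zone {n m k j : ℕ} {σ ε : ℝ} (hσ : |σ| = 1) (hε : 0 < ε) (x : Fin n → ℝ)
    (hx : ∀ i, x i ∈ Icc (-1 : ℝ) 1)
    (hk : (Finset.univ.filter fun i => 1 - σ * x i ≤ ε).card ≤ k) (hkn : k ≤ n)
    (hj : 32 * exp 1 ≤ 4 ^ j * ε) (hm : 2 * 2 ^ j * k ≤ m) :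
    ∃ q ∈ degreeLE ℝ (m : WithBot ℕ), (∀ i, |q.eval (x i)| ≤ 1) ∧
      ∃ g : ℝ → ℝ, Continuous g ∧ (∀ t, 1 - σ * t ∈ Icc 0 (ε / 2) →
        g (1 - σ * t) ≤ q.eval t ^ 2) ∧ (∀ y, 0 ≤ g y) ∧
        ε / 4 * 4 ^ k ≤ ∫ y in ε / 4..ε / 2, g y := by
  classical
  set Z := Finset.univ.filter fun i => 1 - σ * x i ≤ ε with hZ
  obtain ⟨A, hZA, -, hA⟩ := Finset.exists_subsuperset_card_eq (Finset.subset_univ Z) hk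
    (by simpa using hkn)
  have hxσ : ∀ i, 1 - σ * x i ∈ Icc (0 : ℝ) 2 := fun i => by
    have h1 : |σ * x i| ≤ 1 := by rw [abs_mul, hσ, one_mul]; exact abs_le.2 (hx i)
    rw [abs_le] at h1
    exact ⟨by linarith, by linarith⟩
  set c : Fin n → ℝ := fun i => if i ∈ Z then 1 - σ * x i else 0 with hc
  have hcm : ∀ i, c i ∈ Icc 0 ε := fun i => by
    by_cases h : i ∈ Z
    · simp only [hc, h, if_true]
      exact ⟨(hxσ i).1, (Finset.mem_filter.1 h).2⟩
    · simp only [hc, h, if_false]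
      exact ⟨le_rfl, hε.le⟩
  refine ⟨∏ i ∈ A, zoneFactor σ ε j (c i), ?_, fun i => ?_,
    fun y => ∏ i ∈ A, (4 ^ j / 2 * (y - c i)) ^ 2, by fun_prop, fun t ht => ?_,
    fun y => Finset.prod_nonneg fun i _ => sq_nonneg _, ?_⟩
  · rw [mem_degreeLE]
    refine degree_le_of_natDegree_le ((natDegree_prod_le _ _).trans (le_trans ?_ hm))
    refine (Finset.sum_le_sum fun i _ => natDegree_zoneFactor_le σ ε j (c i)).trans ?_
    rw [Finset.sum_const, hA, smul_eq_mul, mul_comm]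
  · rw [eval_prod]
    by_cases h : i ∈ Z
    · rw [Finset.prod_eq_zero (hZA h)]
      · simp
      · exact eval_zoneFactor_eq_zero σ ε j (by simp [hc, h])
    · rw [Finset.abs_prod]
      refine Finset.prod_le_one (fun _ _ => abs_nonneg _) fun l _ => ?_
      have h' : ε < 1 - σ * x i := not_le.1 fun h' =>
        h (Finset.mem_filter.2 ⟨Finset.mem_univ i, h'⟩)
      exact abs_eval_zoneFactor_le_one σ hε.le j (hcm l).2 h'.le (hxσ i).2
  · rw [eval_prod, ← Finset.prod_pow]
    refine Finset.prod_le_prod (fun _ _ => sq_nonneg _) fun l _ => ?_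
    have h := le_abs_eval_zoneFactor j (hcm l) ht
    rw [sq_le_sq, abs_mul, abs_of_pos (by positivity : (0 : ℝ) < 4 ^ j / 2)]
    linarith
  · have := le_integral_prod_zone A c hε j hj
    rwa [hA] at this

/-! ### The Jacobi measure near the endpoint -/

theorem measurable_jacobiWeight (α β : ℝ) : Measurable (jacobiWeight α β) := by
  unfold jacobiWeight
  fun_prop

/-- The sign `σ` marks the endpoint of `[-1, 1]` at which the weight has the larger exponent. -/
theorem exists_sign_jacobiWeight (α β : ℝ) : ∃ σ : ℝ, (σ = 1 ∨ σ = -1) ∧ ∀ x,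
    jacobiWeight α β x =
      jacobiConst α β * (1 - σ * x) ^ max α β * (2 - (1 - σ * x)) ^ min α β := by
  rcases le_total α β with h | h
  · refine ⟨-1, Or.inr rfl, fun x => ?_⟩
    rw [max_eq_right h, min_eq_left h, jacobiWeight]
    ring_nf
  · refine ⟨1, Or.inl rfl, fun x => ?_⟩
    rw [max_eq_left h, min_eq_right h, jacobiWeight]
    ring_nf

theorem measurePreserving_one_sub_mul {σ : ℝ} (hσ : σ = 1 ∨ σ = -1) :
    MeasurePreserving (fun x : ℝ => 1 - σ * x) := by
  rcases hσ with rfl | rfl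
  · simpa using Measure.measurePreserving_sub_left (volume : Measure ℝ) 1
  · simpa [sub_neg_eq_add] using measurePreserving_add_left (volume : Measure ℝ) 1

theorem jacobiMeasure_compl_Icc (α β : ℝ) : jacobiMeasure α β (Icc (-1) 1)ᶜ = 0 := by
  refine withDensity_absolutelyContinuous _ _ ?_
  rw [Measure.restrict_apply measurableSet_Icc.compl, compl_inter_self, measure_empty]

theorem jacobiMeasure_singleton (α β x : ℝ) : jacobiMeasure α β {x} = 0 := by
  refine withDensity_absolutelyContinuous _ _ ?_
  exact measure_singleton x

/-- If the weight were not integrable, `jacobiConst` and the measure would vanish. -/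
theorem jacobiConst_pos (α β : ℝ) [h : IsProbabilityMeasure (jacobiMeasure α β)] :
    0 < jacobiConst α β := by
  refine lt_of_le_of_ne ?_ fun h0 => ?_
  · refine inv_nonneg.2 (intervalIntegral.integral_nonneg (by norm_num) fun x hx => ?_)
    exact mul_nonneg (rpow_nonneg (by linarith [hx.2]) _) (rpow_nonneg (by linarith [hx.1]) _)
  · refine h.ne_zero (jacobiMeasure α β) ?_
    have : (fun x => ENNReal.ofReal (jacobiWeight α β x)) = fun _ => 0 := by
      funext x
      simp [jacobiWeight, ← h0]
    rw [jacobiMeasure, this]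
    exact withDensity_zero

theorem two_sub_rpow_le {s y : ℝ} (hs : -1 < s) (hy : y ∈ Icc (0 : ℝ) 1) :
    (2 - y) ^ s ≤ 2 * 2 ^ s := by
  obtain ⟨h0, h1⟩ := hy
  rcases le_total 0 s with h | h
  · have h2 : (2 - y) ^ s ≤ 2 ^ s := rpow_le_rpow (by linarith) (by linarith) h
    linarith [rpow_nonneg (show (0 : ℝ) ≤ 2 by norm_num) s]
  · refine (rpow_le_one_of_one_le_of_nonpos (by linarith) h).trans ?_
    rw [show (2 : ℝ) * 2 ^ s = 2 ^ (1 + s) by rw [rpow_add (by norm_num), rpow_one]]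
    exact one_le_rpow (by norm_num) (by linarith)

theorem half_le_two_sub_rpow {s y : ℝ} (hs : -1 < s) (hy : y ∈ Icc (0 : ℝ) 1) :
    1 / 2 ≤ (2 - y) ^ s := by
  obtain ⟨h0, h1⟩ := hy
  rcases le_total 0 s with h | h
  · exact le_trans (by norm_num) (one_le_rpow (by linarith) h)
  · calc (1 / 2 : ℝ) = 2 ^ (-1 : ℝ) := by norm_num [rpow_neg_one]
      _ ≤ (2 - y) ^ (-1 : ℝ) :=
        rpow_le_rpow_of_nonpos (by linarith) (by linarith) (by norm_num)
      _ ≤ (2 - y) ^ s := rpow_le_rpow_of_exponent_le (by linarith) hs.le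

theorem lintegral_jacobiMeasure (α β : ℝ) {F : ℝ → ℝ≥0∞} (hF : Measurable F) :
    ∫⁻ x, F x ∂jacobiMeasure α β =
      ∫⁻ x in Icc (-1) 1, ENNReal.ofReal (jacobiWeight α β x) * F x := by
  rw [jacobiMeasure, lintegral_withDensity_eq_lintegral_mul _
    (measurable_jacobiWeight α β).ennreal_ofReal hF]
  rfl

/-- The mass of the endpoint zone `1 - σ x ≤ ε`. -/
theorem jacobiMeasure_zone_le {α β σ ε : ℝ} [IsProbabilityMeasure (jacobiMeasure α β)]
    (hα : -1 < α) (hβ : -1 < β) (hσ : σ = 1 ∨ σ = -1)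
    (hw : ∀ x, jacobiWeight α β x =
      jacobiConst α β * (1 - σ * x) ^ max α β * (2 - (1 - σ * x)) ^ min α β)
    (hε : 0 < ε) (hε1 : ε ≤ 1) :
    jacobiMeasure α β {x | 1 - σ * x ≤ ε} ≤
      ENNReal.ofReal (2 * cbar α β * ε ^ (1 + max α β)) := by
  set c := jacobiConst α β with hc
  have hc0 : 0 < c := jacobiConst_pos α β
  have hγ : -1 < max α β := lt_max_of_lt_left hα
  have hδ : -1 < min α β := lt_min hα hβ
  have hms : MeasurableSet {x : ℝ | 1 - σ * x ≤ ε} := measurableSet_le (by fun_prop) (by fun_prop)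
  have hmp := measurePreserving_one_sub_mul hσ
  rw [jacobiMeasure, withDensity_apply _ hms, Measure.restrict_restrict hms]
  set G : ℝ → ℝ≥0∞ := fun y => ENNReal.ofReal (c * (2 * 2 ^ min α β) * y ^ max α β) with hG
  have hGm : Measurable G := by
    refine Measurable.ennreal_ofReal ?_
    fun_prop
  have hI : ∫ y in (0 : ℝ)..ε, y ^ max α β = ε ^ (1 + max α β) / (1 + max α β) := by
    rw [integral_rpow (Or.inl hγ), zero_rpow (by linarith), sub_zero, add_comm]
  calc _ ≤ ∫⁻ x in (fun x => 1 - σ * x) ⁻¹' Icc 0 ε, ENNReal.ofReal (jacobiWeight α β x) := by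
        refine lintegral_mono_set fun x hx => ⟨?_, hx.1⟩
        rcases hσ with rfl | rfl
        · linarith [hx.2.2]
        · linarith [hx.2.1]
    _ ≤ ∫⁻ x in (fun x => 1 - σ * x) ⁻¹' Icc 0 ε, G (1 - σ * x) := by
        refine setLIntegral_mono (hGm.comp (by fun_prop)) fun x hx => ?_
        refine ENNReal.ofReal_le_ofReal ?_
        have h2 := two_sub_rpow_le hδ ⟨hx.1, hx.2.trans hε1⟩
        have h3 : 0 ≤ (1 - σ * x) ^ max α β := rpow_nonneg hx.1 _
        rw [hw x]
        calc _ ≤ c * (1 - σ * x) ^ max α β * (2 * 2 ^ min α β) :=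
              mul_le_mul_of_nonneg_left h2 (by positivity)
          _ = _ := by ring
    _ = ∫⁻ y in Icc 0 ε, G y := hmp.setLIntegral_comp_preimage measurableSet_Icc hGm
    _ = ENNReal.ofReal (∫ y in Icc 0 ε, c * (2 * 2 ^ min α β) * y ^ max α β) := by
        rw [ofReal_integral_eq_lintegral_ofReal]
        · have := (intervalIntegral.intervalIntegrable_rpow' hγ (a := 0) (b := ε)).const_mul
            (c * (2 * 2 ^ min α β))
          rwa [intervalIntegrable_iff_integrableOn_Icc_of_le hε.le] at this
        · refine (ae_restrict_iff' measurableSet_Icc).2 (Eventually.of_forall fun y hy => ?_)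
          have := rpow_nonneg hy.1 (max α β)
          simp only [Pi.zero_apply]
          positivity
    _ = _ := by
        rw [integral_Icc_eq_integral_Ioc, ← intervalIntegral.integral_of_le hε.le,
          intervalIntegral.integral_const_mul, hI, cbar]
        congr 1
        rw [← hc]
        field_simp

/-- The density is at least a power of `ε` where `ε / 4 ≤ 1 - σ x ≤ ε / 2`. -/
theorem le_integral_jacobiMeasure {α β σ ε : ℝ} [IsProbabilityMeasure (jacobiMeasure α β)]
    (hα : -1 < α) (hβ : -1 < β) (hσ : σ = 1 ∨ σ = -1)
    (hw : ∀ x, jacobiWeight α β x =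
      jacobiConst α β * (1 - σ * x) ^ max α β * (2 - (1 - σ * x)) ^ min α β)
    (hε : 0 < ε) (hε1 : ε ≤ 1) {f g : ℝ → ℝ} (hf : Continuous f) (hf0 : ∀ t, 0 ≤ f t)
    (hg : Continuous g) (hg0 : ∀ y, 0 ≤ g y)
    (hgf : ∀ t, 1 - σ * t ∈ Icc 0 (ε / 2) → g (1 - σ * t) ≤ f t) :
    jacobiConst α β / 2 * (ε / 4) ^ |max α β| * ∫ y in ε / 4..ε / 2, g y ≤
      ∫ t, f t ∂jacobiMeasure α β := by
  set c := jacobiConst α β with hc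
  have hc0 : 0 < c := jacobiConst_pos α β
  have hδ : -1 < min α β := lt_min hα hβ
  have hmp := measurePreserving_one_sub_mul hσ
  have hfi : Integrable f (jacobiMeasure α β) := by
    obtain ⟨M, hM⟩ := (isCompact_Icc (a := (-1 : ℝ)) (b := 1)).exists_bound_of_continuousOn
      hf.continuousOn
    refine Integrable.of_bound hf.aestronglyMeasurable M ?_
    have h0 := measure_eq_zero_iff_ae_notMem.1 (jacobiMeasure_compl_Icc α β)
    filter_upwards [h0] with x hx using hM x (not_not.1 hx)
  set d : ℝ := c / 2 * (ε / 4) ^ |max α β| with hd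
  have hd0 : 0 < d := by positivity
  have hle : ε / 4 ≤ ε / 2 := by linarith
  have hfm : Measurable fun t => ENNReal.ofReal (f t) := hf.measurable.ennreal_ofReal
  have hGm : Measurable fun y => ENNReal.ofReal (d * g y) :=
    (hg.measurable.const_mul d).ennreal_ofReal
  rw [← ENNReal.ofReal_le_ofReal_iff (integral_nonneg hf0),
    ofReal_integral_eq_lintegral_ofReal hfi (Eventually.of_forall hf0),
    lintegral_jacobiMeasure α β hfm, ← intervalIntegral.integral_const_mul,
    intervalIntegral.integral_of_le hle, ← integral_Icc_eq_integral_Ioc,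
    ofReal_integral_eq_lintegral_ofReal (by fun_prop : Continuous _).integrableOn_Icc
      (Eventually.of_forall fun y => mul_nonneg hd0.le (hg0 y)),
    ← hmp.setLIntegral_comp_preimage measurableSet_Icc hGm]
  have hsub : (fun x => 1 - σ * x) ⁻¹' Icc (ε / 4) (ε / 2) ⊆ Icc (-1) 1 := fun x hx => by
    obtain ⟨h1, h2⟩ := hx
    rcases hσ with rfl | rfl
    · constructor <;> linarith
    · constructor <;> linarith
  refine le_trans ?_ (lintegral_mono_set hsub)
  refine setLIntegral_mono
    ((measurable_jacobiWeight α β).ennreal_ofReal.mul hfm) fun x hx => ?_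
  obtain ⟨h1, h2⟩ := hx
  have hy0 : 0 < 1 - σ * x := by linarith
  rw [← ENNReal.ofReal_mul' (hf0 x)]
  refine ENNReal.ofReal_le_ofReal ?_
  refine mul_le_mul ?_ (hgf x ⟨hy0.le, h2⟩) (hg0 _) ?_
  · rw [hw x, hd]
    have e1 : (ε / 4) ^ |max α β| ≤ (1 - σ * x) ^ max α β :=
      (rpow_le_rpow (by positivity) h1 (abs_nonneg _)).trans
        (rpow_le_rpow_of_exponent_ge hy0 (by linarith) (le_abs_self _))
    have e2 := half_le_two_sub_rpow hδ (y := 1 - σ * x) ⟨hy0.le, by linarith⟩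
    calc c / 2 * (ε / 4) ^ |max α β| = c * (ε / 4) ^ |max α β| * (1 / 2) := by ring
      _ ≤ _ := by gcongr
  · rw [hw x]
    have := rpow_pos_of_pos (show 0 < 2 - (1 - σ * x) by linarith) (min α β)
    positivity

/-! ### Random sample points -/

theorem ae_injective_of_iIndepFun {Ω : Type*} [MeasurableSpace Ω] {P : Measure Ω}
    [IsProbabilityMeasure P] {ρ : Measure ℝ} (hρ : ∀ x, ρ {x} = 0) {n : ℕ} {X : Fin n → Ω → ℝ}
    (hX : ∀ i, HasLaw (X i) ρ P) (hind : iIndepFun X P) :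
    ∀ᵐ ω ∂P, Function.Injective fun i => X i ω := by
  have key : ∀ i j, i ≠ j → ∀ᵐ ω ∂P, X i ω ≠ X j ω := by
    intro i j hij
    have hρp : IsProbabilityMeasure ρ := (hX i).isProbabilityMeasure_iff.1 inferInstance
    have h1 := (indepFun_iff_map_prod_eq_prod_map_map (hX i).aemeasurable
      (hX j).aemeasurable).1 (hind.indepFun hij)
    rw [(hX i).map_eq, (hX j).map_eq] at h1
    have hd : MeasurableSet {p : ℝ × ℝ | p.1 = p.2} := measurableSet_eq_fun measurable_fst
      measurable_snd
    have h2 : ρ.prod ρ {p : ℝ × ℝ | p.1 = p.2} = 0 := by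
      rw [Measure.measure_prod_null hd]
      refine Eventually.of_forall fun x => ?_
      refine measure_mono_null (fun y hy => ?_) (hρ x)
      exact (Eq.symm hy : y = x)
    rw [← h1, Measure.map_apply_of_aemeasurable
      ((hX i).aemeasurable.prodMk (hX j).aemeasurable) hd] at h2
    exact measure_eq_zero_iff_ae_notMem.1 h2
  have hall : ∀ᵐ ω ∂P, ∀ i j, i ≠ j → X i ω ≠ X j ω := by
    rw [ae_all_iff]; intro i
    rw [ae_all_iff]; intro j
    by_cases hij : i = j
    · exact Eventually.of_forall fun ω h => absurd hij h
    · filter_upwards [key i j hij] with ω h _ using h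
  filter_upwards [hall] with ω h i j hij
  by_contra hne
  exact h i j hne hij

open Classical in
/-- Markov's inequality for the number of sample points in `s`. -/
theorem measure_le_card_filter_mem_le {Ω : Type*} [MeasurableSpace Ω] {P : Measure Ω}
    {ρ : Measure ℝ} {n : ℕ} {X : Fin n → Ω → ℝ} (hX : ∀ i, HasLaw (X i) ρ P) {s : Set ℝ}
    (hs : MeasurableSet s) {p K : ℝ} (hp : ρ s ≤ ENNReal.ofReal p) (hK : 0 < K) :
    P {ω | K ≤ ((Finset.univ.filter fun i => X i ω ∈ s).card : ℝ)} ≤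
      ENNReal.ofReal (n * p / K) := by
  have hm : ∀ i, AEMeasurable (fun ω => s.indicator (fun _ => (1 : ℝ≥0∞)) (X i ω)) P := fun i =>
    (measurable_const.indicator hs).comp_aemeasurable (hX i).aemeasurable
  have hm' : AEMeasurable (fun ω => ∑ i, s.indicator (fun _ => (1 : ℝ≥0∞)) (X i ω)) P :=
    Finset.aemeasurable_fun_sum _ fun i _ => hm i
  have hcard : ∀ ω, ∑ i, s.indicator (fun _ => (1 : ℝ≥0∞)) (X i ω) =
      ((Finset.univ.filter fun i => X i ω ∈ s).card : ℝ≥0∞) := fun ω => by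
    simp [Set.indicator_apply]
  have hset : {ω | K ≤ ((Finset.univ.filter fun i => X i ω ∈ s).card : ℝ)} =
      {ω | ENNReal.ofReal K ≤ ∑ i, s.indicator (fun _ => (1 : ℝ≥0∞)) (X i ω)} := by
    ext ω
    rw [mem_ofPred_eq, mem_ofPred_eq, hcard, ← ENNReal.ofReal_natCast,
      ENNReal.ofReal_le_ofReal_iff (Nat.cast_nonneg _)]
  rw [hset]
  refine (meas_ge_le_lintegral_div hm' (by simpa using hK) ENNReal.ofReal_ne_top).trans ?_
  rw [lintegral_finsetSum' _ fun i _ => hm i]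
  have hi : ∀ i, ∫⁻ ω, s.indicator (fun _ => (1 : ℝ≥0∞)) (X i ω) ∂P = ρ s := fun i => by
    rw [(hX i).lintegral_comp (f := s.indicator fun _ => (1 : ℝ≥0∞))
      (measurable_const.indicator hs).aemeasurable, lintegral_indicator_const hs, one_mul]
  simp_rw [hi]
  rw [Finset.sum_const, Finset.card_univ, Fintype.card_fin, nsmul_eq_mul,
    ENNReal.ofReal_div_of_pos hK, ENNReal.ofReal_mul (Nat.cast_nonneg _), ENNReal.ofReal_natCast]
  gcongr

/-- If the endpoint zone holds fewer than `K` sample points, which fails with probability at most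
`n ρ(zone) / K`, then the condition number is of order `2 ^ K`, up to powers of `ε`. -/
theorem le_measure_condNumber {α β ε K : ℝ} (hα : -1 < α) (hβ : -1 < β) (hε : 0 < ε)
    (hε1 : ε ≤ 1) (hK : 0 < K) {n m j : ℕ} (hmn : m < n) (hj : 32 * exp 1 ≤ 4 ^ j * ε)
    (hm : 2 * 2 ^ j * ⌈K⌉₊ ≤ m) {Ω : Type*} [MeasurableSpace Ω] {P : Measure Ω}
    [IsProbabilityMeasure P] {X : Fin n → Ω → ℝ}
    (hX : ∀ i, HasLaw (X i) (jacobiMeasure α β) P) (hind : iIndepFun X P) :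
    ENNReal.ofReal (1 - n * (2 * cbar α β * ε ^ (1 + max α β)) / K) ≤
      P {ω | ENNReal.ofReal
          √(jacobiConst α β / 2 * (ε / 4) ^ |max α β| * (ε / 4 * 4 ^ ⌈K⌉₊)) ≤
        condNumber (jacobiMeasure α β) (fun i => X i ω) (lsProj m fun i => X i ω)} := by
  classical
  have hρ : IsProbabilityMeasure (jacobiMeasure α β) :=
    (hX ⟨0, by omega⟩).isProbabilityMeasure_iff.1 inferInstance
  obtain ⟨σ, hσ, hw⟩ := exists_sign_jacobiWeight α β
  have hσ1 : |σ| = 1 := by rcases hσ with rfl | rfl <;> simp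
  have hc0 := jacobiConst_pos α β
  have hkn : ⌈K⌉₊ ≤ n := by
    have h1 : 1 ≤ 2 * 2 ^ j := Nat.succ_le_of_lt (by positivity)
    nlinarith
  have hms : MeasurableSet {x : ℝ | 1 - σ * x ≤ ε} := measurableSet_le (by fun_prop) (by fun_prop)
  have hmarkov := measure_le_card_filter_mem_le hX hms
    (jacobiMeasure_zone_le hα hβ hσ hw hε hε1) hK
  have hinj := ae_injective_of_iIndepFun (jacobiMeasure_singleton α β) hX hind
  have hmem : ∀ᵐ ω ∂P, ∀ i, X i ω ∈ Icc (-1 : ℝ) 1 := by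
    rw [ae_all_iff]
    intro i
    have h0 := jacobiMeasure_compl_Icc α β
    rw [← (hX i).map_eq, Measure.map_apply_of_aemeasurable (hX i).aemeasurable
      measurableSet_Icc.compl] at h0
    filter_upwards [measure_eq_zero_iff_ae_notMem.1 h0] with ω hω using not_not.1 hω
  set B := {ω | K ≤ ((Finset.univ.filter fun i => X i ω ∈ {x : ℝ | 1 - σ * x ≤ ε}).card : ℝ)}
    with hB
  set T := {ω | ENNReal.ofReal
          √(jacobiConst α β / 2 * (ε / 4) ^ |max α β| * (ε / 4 * 4 ^ ⌈K⌉₊)) ≤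
        condNumber (jacobiMeasure α β) (fun i => X i ω) (lsProj m fun i => X i ω)} with hT
  have hcover : ∀ᵐ ω ∂P, ω ∈ T ∪ B := by
    filter_upwards [hinj, hmem] with ω hω1 hω2
    by_cases hωB : ω ∈ B
    · exact Or.inr hωB
    refine Or.inl ?_
    have hcard : (Finset.univ.filter fun i => 1 - σ * X i ω ≤ ε).card ≤ ⌈K⌉₊ := by
      have h1 : ¬ K ≤ ((Finset.univ.filter fun i => 1 - σ * X i ω ≤ ε).card : ℝ) := hωB
      exact_mod_cast (not_le.1 h1).le.trans (Nat.le_ceil K)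
    obtain ⟨q, hq, hq1, g, hg, hgq, hg0, hgI⟩ :=
      exists_polynomial_zone hσ1 hε (fun i => X i ω) hω2 hcard hkn hj hm
    refine le_trans (ENNReal.ofReal_le_ofReal (sqrt_le_sqrt ?_))
      (ofReal_l2Norm_le_condNumber (jacobiMeasure α β) hω1 hmn hq hq1)
    refine le_trans (mul_le_mul_of_nonneg_left hgI (by positivity)) ?_
    exact le_integral_jacobiMeasure hα hβ hσ hw hε hε1 (by fun_prop) (fun t => sq_nonneg _) hg hg0
      hgq
  have h1 : 1 ≤ P T + ENNReal.ofReal (n * (2 * cbar α β * ε ^ (1 + max α β)) / K) := by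
    calc (1 : ℝ≥0∞) = P univ := measure_univ.symm
      _ ≤ P (T ∪ B) := measure_mono_ae (by filter_upwards [hcover] with ω hω _ using hω)
      _ ≤ P T + P B := measure_union_le T B
      _ ≤ _ := add_le_add le_rfl hmarkov
  have hcb : 0 ≤ cbar α β := by
    have : 0 < 1 + max α β := by linarith [lt_max_of_lt_left hα (c := β)]
    unfold cbar
    positivity
  rw [ENNReal.ofReal_sub _ (by positivity), ENNReal.ofReal_one]
  exact tsub_le_iff_right.2 h1

/-! ### Choice of the zone and asymptotics -/

theorem eventually_rpow_le_mul_exp_rpow (q : ℝ) {r a D : ℝ} (hr : 0 < r) (ha : 0 < a)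
    (hD : 0 < D) : ∀ᶠ n : ℕ in atTop, (n : ℝ) ^ q ≤ D * exp (a * (n : ℝ) ^ r) := by
  have h := ((tendsto_exp_mul_div_rpow_atTop (q / r) a ha).comp
    (tendsto_rpow_atTop hr)).comp (tendsto_natCast_atTop_atTop (R := ℝ))
  filter_upwards [h.eventually_ge_atTop (1 / D), eventually_gt_atTop 0] with n hn hn0
  have hn' : (0 : ℝ) < n := by exact_mod_cast hn0
  simp only [Function.comp_apply] at hn
  rw [← rpow_mul hn'.le, mul_div_cancel₀ _ hr.ne', div_le_div_iff₀ hD (by positivity)] at hn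
  linarith

theorem rpow_div_le_of_le_mul_rpow {n m b τ : ℝ} (hn : 0 < n) (hm : 0 ≤ m) (hb : 0 < b)
    (hτ : 0 < τ) (hτ1 : τ ≤ 1) (h : n ≤ b * m ^ (1 / τ)) : n ^ τ / max 1 b ≤ m := by
  have h1 : (n / b) ^ τ ≤ m := by
    have h2 : n / b ≤ m ^ (1 / τ) := by rw [div_le_iff₀ hb]; linarith
    refine (rpow_le_rpow (by positivity) h2 hτ.le).trans (le_of_eq ?_)
    rw [← rpow_mul hm, one_div_mul_cancel hτ.ne', rpow_one]
  refine le_trans ?_ h1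
  rw [div_rpow hn.le hb.le]
  have h3 : b ^ τ ≤ max 1 b :=
    (rpow_le_rpow hb.le (le_max_right 1 b) hτ.le).trans
      (by simpa using rpow_le_rpow_of_exponent_le (le_max_left 1 b) hτ1)
  gcongr

/-- The degree times the square root of the zone width is at least a multiple of the exponent
`n ^ r / C ^ (1 / (1 + 2 γ))` of the theorem. -/
theorem le_mul_rpow_zone {γ lam B C τ n m : ℝ} (hγ : -1 / 2 < γ) (hlam : 0 < lam) (hB : 0 < B)
    (hC : 0 < C) (hn : 0 < n) (hm : n ^ τ / B ≤ m) :
    (lam / B ^ (2 + 2 * γ)) ^ (1 / (1 + 2 * γ)) *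
        (n ^ ((2 * (1 + γ) * τ - 1) / (1 + 2 * γ)) / C ^ (1 / (1 + 2 * γ))) ≤
      m * (lam * m / (n * C)) ^ (1 / (1 + 2 * γ)) := by
  have hg : 0 < 1 + 2 * γ := by linarith
  have hnτ : 0 < n ^ τ := rpow_pos_of_pos hn τ
  have hm0 : 0 < m := lt_of_lt_of_le (by positivity) hm
  have hBp : 0 < B ^ (2 + 2 * γ) := rpow_pos_of_pos hB _
  have e1 : m * (lam * m / (n * C)) ^ (1 / (1 + 2 * γ)) =
      (lam * m ^ (2 + 2 * γ) / (n * C)) ^ (1 / (1 + 2 * γ)) := by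
    nth_rewrite 1 [show m = (m ^ (1 + 2 * γ)) ^ (1 / (1 + 2 * γ)) by
      rw [← rpow_mul hm0.le, mul_one_div_cancel hg.ne', rpow_one]]
    rw [← mul_rpow (by positivity) (by positivity),
      show 2 + 2 * γ = (1 + 2 * γ) + 1 by ring,
      rpow_add hm0 (1 + 2 * γ) 1, rpow_one]
    congr 1; ring
  have e2 : (lam / B ^ (2 + 2 * γ)) ^ (1 / (1 + 2 * γ)) *
        (n ^ ((2 * (1 + γ) * τ - 1) / (1 + 2 * γ)) / C ^ (1 / (1 + 2 * γ))) =
      (lam * (n ^ τ / B) ^ (2 + 2 * γ) / (n * C)) ^ (1 / (1 + 2 * γ)) := by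
    rw [show n ^ ((2 * (1 + γ) * τ - 1) / (1 + 2 * γ)) =
        (n ^ (2 * (1 + γ) * τ - 1)) ^ (1 / (1 + 2 * γ)) by rw [← rpow_mul hn.le, mul_one_div],
      ← div_rpow (by positivity) hC.le, ← mul_rpow (by positivity) (by positivity)]
    congr 1
    rw [div_rpow hnτ.le hB.le, ← rpow_mul hn.le, rpow_sub hn, rpow_one,
      show 2 * (1 + γ) * τ = τ * (2 + 2 * γ) by ring]
    field_simp
  rw [e1, e2]
  have h2γ : 0 ≤ 2 + 2 * γ := by linarith
  have := rpow_le_rpow (by positivity) hm h2γ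
  gcongr

/-- If the zone of width `δ ^ 2` is wide compared with `M ^ (-2)`, then `⌈K⌉` factors of degree
`2 * 2 ^ j`, with `2 ^ j` of order `1 / δ`, fit into the degree `M`. -/
theorem exists_pow_zone {δ K : ℝ} {M : ℕ} (hδ : 0 < δ) (hδ1 : δ ≤ 1) (hK0 : 0 ≤ K)
    (hK : K ≤ M * δ / 76) (hM : 76 ≤ M * δ) :
    ∃ j : ℕ, 32 * exp 1 ≤ 4 ^ j * δ ^ 2 ∧ 2 * 2 ^ j * ⌈K⌉₊ ≤ M := by
  have hδ2 : 0 < δ ^ 2 := by positivity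
  have he1 : exp 1 < 2.7182818286 := exp_one_lt_d9
  have he0 : 1 ≤ exp 1 := one_le_exp zero_le_one
  obtain ⟨j, hj1, hj2⟩ := exists_nat_pow_near (x := 128 * exp 1 / δ ^ 2) (y := 4)
    (by rw [one_le_div hδ2]; nlinarith) (by norm_num)
  rw [le_div_iff₀ hδ2] at hj1
  rw [div_lt_iff₀ hδ2, pow_succ] at hj2
  refine ⟨j, by linarith, ?_⟩
  have hL : 2 ^ j * δ ≤ 19 := by
    refine le_of_sq_le_sq ?_ (by norm_num)
    rw [mul_pow, ← pow_mul, mul_comm j, pow_mul]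
    norm_num
    linarith
  have hceil := Nat.ceil_lt_add_one hK0
  have hreal : (2 * 2 ^ j * ⌈K⌉₊ : ℝ) ≤ M := by
    refine le_of_mul_le_mul_right ?_ hδ
    have hc0 : (0 : ℝ) ≤ ⌈K⌉₊ := Nat.cast_nonneg _
    nlinarith [mul_le_mul_of_nonneg_right hL hc0]
  exact_mod_cast hreal

/-- The exponential growth in the degree absorbs the powers of the zone width. -/
theorem eventually_growth {lam κ g r p d C : ℝ} (hlam : 0 < lam) (hκ : 0 < κ)
    (hr : 0 < r) (hp : 0 ≤ p) (hd : 0 < d) (hC : 0 < C) :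
    ∀ᶠ n : ℕ in atTop, ∀ δ K : ℝ, (lam / (n * C)) ^ (1 / g) ≤ δ →
      lam * (κ * ((n : ℝ) ^ r / C ^ (1 / g))) / exp 2 ≤ K →
        ((2 ^ (lam * κ / (2 * exp 2)) : ℝ) ^ ((n : ℝ) ^ r / C ^ (1 / g))) ^ 2 ≤
          d * (δ ^ 2 / 4) ^ p * 4 ^ ⌈K⌉₊ := by
  set w : ℝ := lam * κ / (2 * exp 2) with hw
  have hw0 : 0 < w := by positivity
  set D : ℝ := d * ((lam / C) ^ (2 / g) / 4) ^ p with hD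
  have hCg : 0 < C ^ (1 / g) := rpow_pos_of_pos hC _
  have hlog : 0 < log 2 := log_pos (by norm_num)
  filter_upwards [eventually_rpow_le_mul_exp_rpow (2 / g * p) (D := D)
    (a := 2 * log 2 * w / C ^ (1 / g)) hr (by positivity) (by positivity),
    eventually_gt_atTop 0] with n hn hn0 δ K hδ hK
  have hn' : (0 : ℝ) < n := by exact_mod_cast hn0
  set R : ℝ := (n : ℝ) ^ r / C ^ (1 / g) with hR
  have hexp : exp (2 * log 2 * w / C ^ (1 / g) * (n : ℝ) ^ r) = (2 ^ w : ℝ) ^ (2 * R) := by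
    rw [← rpow_mul zero_le_two, rpow_def_of_pos zero_lt_two, hR]
    congr 1; ring
  have hsq : ((2 ^ w : ℝ) ^ R) ^ 2 = (2 ^ w : ℝ) ^ (2 * R) := by
    rw [← rpow_natCast, ← rpow_mul (by positivity), mul_comm]; norm_num
  rw [hexp] at hn
  have hpow : ((2 ^ w : ℝ) ^ (2 * R)) ^ 2 ≤ 4 ^ ⌈K⌉₊ := by
    have h1 : ((2 ^ w : ℝ) ^ (2 * R)) ^ 2 = 2 ^ (2 * (lam * (κ * R) / exp 2)) := by
      rw [← rpow_mul zero_le_two, ← rpow_natCast, ← rpow_mul zero_le_two, hw]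
      congr 1
      push_cast
      field_simp
    have h2 : (4 : ℝ) ^ ⌈K⌉₊ = 2 ^ (2 * (⌈K⌉₊ : ℝ)) := by
      rw [rpow_mul zero_le_two, rpow_natCast]; norm_num
    rw [h1, h2]
    exact rpow_le_rpow_of_exponent_le one_le_two
      (mul_le_mul_of_nonneg_left (hK.trans (Nat.le_ceil K)) zero_le_two)
  have hzone : D ≤ d * (δ ^ 2 / 4) ^ p * (n : ℝ) ^ (2 / g * p) := by
    have h1 : (lam / C) ^ (2 / g) / (n : ℝ) ^ (2 / g) ≤ δ ^ 2 := by
      rw [← div_rpow (by positivity) hn'.le]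
      calc (lam / C / n) ^ (2 / g) = ((lam / (n * C)) ^ (1 / g)) ^ 2 := by
            rw [← rpow_natCast, ← rpow_mul (by positivity)]
            congr 1
            · field_simp
            · push_cast; ring
        _ ≤ δ ^ 2 := by gcongr
    have hng : 0 < (n : ℝ) ^ (2 / g) := by positivity
    rw [div_le_iff₀ hng] at h1
    rw [hD, rpow_mul hn'.le, mul_assoc, ← mul_rpow (by positivity) (by positivity)]
    gcongr
    linarith
  have hpos : 0 < (2 ^ w : ℝ) ^ (2 * R) := by positivity
  rw [hsq]
  have hnq : 0 < (n : ℝ) ^ (2 / g * p) := by positivity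
  have hone : 1 ≤ d * (δ ^ 2 / 4) ^ p * (2 ^ w : ℝ) ^ (2 * R) := by
    have h3 := mul_le_mul_of_nonneg_right hzone hpos.le
    have h4 : (n : ℝ) ^ (2 / g * p) * 1 ≤
        (n : ℝ) ^ (2 / g * p) * (d * (δ ^ 2 / 4) ^ p * (2 ^ w : ℝ) ^ (2 * R)) := by linarith
    exact le_of_mul_le_mul_left h4 hnq
  calc (2 ^ w : ℝ) ^ (2 * R) = 1 * (2 ^ w : ℝ) ^ (2 * R) := (one_mul _).symm
    _ ≤ d * (δ ^ 2 / 4) ^ p * (2 ^ w : ℝ) ^ (2 * R) * (2 ^ w : ℝ) ^ (2 * R) := by gcongr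
    _ = d * (δ ^ 2 / 4) ^ p * ((2 ^ w : ℝ) ^ (2 * R)) ^ 2 := by ring
    _ ≤ _ := by gcongr

end LeastSquares

end

/-! ### The lower bound for the condition number -/

theorem theorem1p4
    (γ : ℝ) (hγ : -1 / 2 < γ)
    -- the upper constant of `n ≍ m^{1/τ}`, and a positive lower bound for `C`
    (b : ℝ) (hb : 0 < b) (C₀ : ℝ) (hC₀ : 0 < C₀) :
    ∃ ν : ℝ, 1 < ν ∧
      -- the lower constant of `n ≍ m^{1/τ}`
      ∀ a : ℝ, 0 < a → ∃ η : ℝ, 0 < η ∧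
        ∀ α β τ C : ℝ, -1 < α → -1 < β → max α β = γ →
          0 < τ → τ ≤ 1 → 1 / (2 * (1 + γ)) < τ →
          C₀ ≤ C → 2 * exp 2 * LeastSquares.cbar α β < C →
        ∀ m : ℕ → ℕ, (∀ᶠ n : ℕ in atTop, m n < n) →
          (∀ᶠ n : ℕ in atTop, a * (m n : ℝ) ^ (1 / τ) ≤ n ∧ (n : ℝ) ≤ b * (m n : ℝ) ^ (1 / τ)) →
        ∀ (Ω : Type u) [MeasurableSpace Ω] (P : Measure Ω) [IsProbabilityMeasure P]
          (X : (n : ℕ) → Fin n → Ω → ℝ),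
          (∀ n i, HasLaw (X n i) (LeastSquares.jacobiMeasure α β) P) →
          (∀ n, iIndepFun (X n) P) →
        ∀ᶠ n : ℕ in atTop,
          ENNReal.ofReal (1 - 2 * exp 2 * LeastSquares.cbar α β / C) ≤
            P {ω | ENNReal.ofReal
                    (η / (n : ℝ) ^ ((1 + γ) * τ) *
                      ν ^ ((n : ℝ) ^ ((2 * (1 + γ) * τ - 1) / (1 + 2 * γ)) /
                        C ^ (1 / (1 + 2 * γ)))) ≤
                  LeastSquares.condNumber (LeastSquares.jacobiMeasure α β)
                    (fun i => X n i ω) (LeastSquares.lsProj (m n) fun i => X n i ω)} := by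
  have hg : 0 < 1 + 2 * γ := by linarith
  -- The bound `C₀` keeps the zone width at most one, and `1 / 76` keeps the degree at most `m`.
  set lam : ℝ := min (1 / 76) C₀ with hlam_def
  have hlam : 0 < lam := lt_min (by norm_num) hC₀
  set B : ℝ := max 1 b with hB_def
  have hB : 0 < B := lt_max_of_lt_left one_pos
  set κ : ℝ := (lam / B ^ (2 + 2 * γ)) ^ (1 / (1 + 2 * γ)) with hκ_def
  have hκ : 0 < κ := by positivity
  refine ⟨2 ^ (lam * κ / (2 * exp 2)), one_lt_rpow one_lt_two (by positivity), fun a _ =>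
    ⟨1, one_pos, ?_⟩⟩
  intro α β τ C hα hβ hαβ hτ hτ1 hτγ hC₀C _ m hmn hnm Ω _ P _ X hX hind
  have hC : 0 < C := hC₀.trans_le hC₀C
  have hr : 0 < (2 * (1 + γ) * τ - 1) / (1 + 2 * γ) := by
    rw [div_lt_iff₀ (by linarith)] at hτγ
    exact div_pos (by linarith) hg
  have hc0 : 0 < LeastSquares.jacobiConst α β := by
    have := (hX 1 0).isProbabilityMeasure_iff.1 inferInstance
    exact LeastSquares.jacobiConst_pos α β
  have hCg : 0 < C ^ (1 / (1 + 2 * γ)) := by positivity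
  have hlarge : ∀ᶠ n : ℕ in atTop, 76 ≤ κ * ((n : ℝ) ^ ((2 * (1 + γ) * τ - 1) / (1 + 2 * γ)) /
      C ^ (1 / (1 + 2 * γ))) :=
    ((((tendsto_rpow_atTop hr).comp
      (tendsto_natCast_atTop_atTop (R := ℝ))).atTop_div_const hCg).const_mul_atTop
        hκ).eventually_ge_atTop 76
  filter_upwards [hmn, hnm, hlarge, eventually_gt_atTop 0,
    LeastSquares.eventually_growth (p := 1 + |γ|) (d := LeastSquares.jacobiConst α β / 2)
      hlam hκ hr (by positivity) (by positivity) hC] with n hmn hnm hlarge hn0 hgrowth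
  have hn : (0 : ℝ) < n := by exact_mod_cast hn0
  have hn1 : (1 : ℝ) ≤ n := by exact_mod_cast hn0
  have hmn' : (m n : ℝ) ≤ n := by exact_mod_cast hmn.le
  have hmB := LeastSquares.rpow_div_le_of_le_mul_rpow hn (Nat.cast_nonneg (m n)) hb hτ hτ1 hnm.2
  have hm0 : (0 : ℝ) < m n := lt_of_lt_of_le (by positivity) hmB
  have hm1 : (1 : ℝ) ≤ m n := by exact_mod_cast (Nat.cast_pos.1 hm0)
  -- the square root of the zone width
  set δ : ℝ := (lam * m n / (n * C)) ^ (1 / (1 + 2 * γ)) with hδ_def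
  have hδ : 0 < δ := by positivity
  have hδ1 : δ ≤ 1 := by
    refine rpow_le_one (by positivity) ?_ (by positivity)
    rw [div_le_one (by positivity), mul_comm (n : ℝ)]
    exact mul_le_mul ((min_le_right _ _).trans hC₀C) hmn' hm0.le hC.le
  have hδg : δ ^ (1 + 2 * γ) = lam * m n / (n * C) := by
    rw [hδ_def, ← rpow_mul (by positivity), one_div_mul_cancel hg.ne', rpow_one]
  have hκδ := LeastSquares.le_mul_rpow_zone (τ := τ) hγ hlam hB hC hn hmB
  set R : ℝ := (n : ℝ) ^ ((2 * (1 + γ) * τ - 1) / (1 + 2 * γ)) / C ^ (1 / (1 + 2 * γ)) with hR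
  set K : ℝ := lam * (m n * δ) / exp 2 with hK_def
  have hK : 0 < K := by positivity
  have hK76 : K ≤ m n * δ / 76 := by
    have h1 : lam ≤ 1 / 76 := min_le_left _ _
    have h2 : (1 : ℝ) ≤ exp 2 := one_le_exp zero_le_two
    calc K ≤ lam * (m n * δ) := div_le_self (by positivity) h2
      _ ≤ 1 / 76 * (m n * δ) := by gcongr
      _ = _ := by ring
  obtain ⟨j, hj, hjm⟩ := LeastSquares.exists_pow_zone hδ hδ1 hK.le hK76 (hlarge.trans hκδ)
  have hmain := LeastSquares.le_measure_condNumber hα hβ (by positivity)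
    (pow_le_one₀ hδ.le hδ1 : δ ^ 2 ≤ 1) hK hmn hj hjm (hX n) (hind n)
  have hprob : n * (2 * LeastSquares.cbar α β * (δ ^ 2) ^ (1 + max α β)) / K =
      2 * exp 2 * LeastSquares.cbar α β / C := by
    have h1 : (δ ^ 2) ^ (1 + max α β) = lam * m n / (n * C) * δ := by
      rw [hαβ, ← rpow_natCast, ← rpow_mul hδ.le, ← hδg, ← rpow_add_one hδ.ne']
      congr 1; push_cast; ring
    rw [h1, hK_def]
    field_simp
  rw [hprob] at hmain
  refine hmain.trans (measure_mono fun ω hω => le_trans (ENNReal.ofReal_le_ofReal ?_) hω)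
  have hpow : 1 ≤ (n : ℝ) ^ ((1 + γ) * τ) :=
    one_le_rpow hn1 (mul_nonneg (by linarith) hτ.le)
  have hδlow : (lam / (n * C)) ^ (1 / (1 + 2 * γ)) ≤ δ := by
    have h1 : lam ≤ lam * m n := le_mul_of_one_le_right hlam.le hm1
    rw [hδ_def]
    gcongr
  have hfin := hgrowth δ K hδlow (by rw [hK_def]; gcongr)
  refine (mul_le_of_le_one_left (by positivity) ((div_le_one (by positivity)).2 hpow)).trans ?_
  refine le_sqrt_of_sq_le (hfin.trans (le_of_eq ?_))
  rw [hαβ, rpow_add (by positivity), rpow_one]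
  ring
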